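/- All manifolds are smooth, finite-dimensional, Hausdorff, second countable and without boundary, and all maps are smooth. Let $G$ be a Lie group, let $M$ be a manifold with a smooth left action $G\times M\to M$, $(g,m)\mapsto g_M(m)$, and let $E\to M$ be a real vector bundle of finite rank, with space of smooth sections $\Gamma E$. A *semi-linear isomorphism* of $\Gamma E$ is an $\mathbb R$-linear automorphism $\mu$ of $\Gamma E$ for which there is an $\mathbb R$-linear automorphism $\mu^M$ of $C^\infty(M)$ with $\mu(f\psi)=\mu^M(f)\,\mu(\psi)$ for all $f\in C^\infty(M)$ and $\psi\in\Gamma E$. A *semi-linear representation* of $G$ on $E$ is a group morphism $R$ from $G$ to the group of semi-linear isomorphisms of $\Gamma E$ such that, for every $\psi\in\Gamma E$, the map $G\times M\to E$, $(g,m)\mapsto (R(g)\psi)(m)$, is smooth. It is *associated to the given action* if $R(g)(f\psi)=(f\circ (g_M)^{-1})\,R(g)\psi$ for all $g\in G$, $f\in C^\infty(M)$ and $\psi\in\Gamma E$. The *action groupoid* $G\ltimes M$ is the Lie groupoid with base $M$ and manifold of arrows $G\times M$, with source $(g,m)\mapsto m$, target $(g,m)\mapsto g_M(m)$ and product $(g_1,m_1)(g_2,m_2)=(g_1g_2,m_2)$,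 defined when $m_1=(g_2)_M(m_2)$. Let $\Phi(E)$ be the Lie groupoid with base $M$ whose arrows are the linear isomorphisms $E_x\to E_y$ ($x,y\in M$), with the composition of maps and the smooth structure given by locally identifying $\Phi(M\times F)$ with $M\times GL(F)\times M$. A *representation* of $G\ltimes M$ on $E$ is a base-preserving morphism of Lie groupoids $\rho\colon G\ltimes M\to\Phi(E)$. **Theorem.** There is a bijection $R\mapsto\rho$ from the set of semi-linear representations of $G$ on $E$ associated to the given action onto the set of representations of the action groupoid $G\ltimes M$ on $E$, such that $$\rho(g,m)\bigl(\psi(m)\bigr)=(R(g)\psi)\bigl(g_M(m)\bigr)\qquad\text{for all } g\in G,\ m\in M,\ \psi\in\Gamma E .$$ -/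

import Mathlib

open Bundle Set Function Topology
open scoped Manifold ContDiff

namespace GroupoidReps

noncomputable section

/-! ### Lie groupoids and base-preserving morphisms -/

section LieGroupoid

variable {EM HM : Type*} [NormedAddCommGroup EM] [NormedSpace ℝ EM] [TopologicalSpace HM]
  {EA HA : Type*} [NormedAddCommGroup EA] [NormedSpace ℝ EA] [TopologicalSpace HA]
  {EB HB : Type*} [NormedAddCommGroup EB] [NormedSpace ℝ EB] [TopologicalSpace HB]

/-- A Lie groupoid with base manifold `M` and manifold of arrows `A`. The product `mul a b` is
defined if and only if `src a = tgt b`. Its smoothness on the fibred product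
`{(a, b) | src a = tgt b}` is smoothness on this (embedded, as `src` and `tgt` are submersions)
subset of `A × A`. -/
structure LieGroupoid (I : ModelWithCorners ℝ EM HM) (M : Type*) [TopologicalSpace M]
    [ChartedSpace HM M] [IsManifold I ∞ M] (J : ModelWithCorners ℝ EA HA) (A : Type*)
    [TopologicalSpace A] [ChartedSpace HA A] [IsManifold J ∞ A] where
  src : A → M
  tgt : A → M
  one : M → A
  inv : A → A
  mul : (a b : A) → src a = tgt b → A
  src_one : ∀ x, src (one x) = x
  tgt_one : ∀ x, tgt (one x) = x
  src_inv : ∀ a, src (inv a) = tgt a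
  tgt_inv : ∀ a, tgt (inv a) = src a
  src_mul : ∀ a b h, src (mul a b h) = src b
  tgt_mul : ∀ a b h, tgt (mul a b h) = tgt a
  mul_assoc : ∀ a b c (hab : src a = tgt b) (hbc : src b = tgt c),
    mul (mul a b hab) c ((src_mul a b hab).trans hbc) =
      mul a (mul b c hbc) (hab.trans (tgt_mul b c hbc).symm)
  one_mul : ∀ a, mul (one (tgt a)) a (src_one _) = a
  mul_one : ∀ a, mul a (one (src a)) (tgt_one _).symm = a
  inv_mul : ∀ a, mul (inv a) a (src_inv a) = one (src a)
  mul_inv : ∀ a, mul a (inv a) (tgt_inv a).symm = one (tgt a)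
  contMDiff_src : ContMDiff J I ∞ src
  contMDiff_tgt : ContMDiff J I ∞ tgt
  submersion_src : ∀ a, Surjective (mfderiv J I src a)
  submersion_tgt : ∀ a, Surjective (mfderiv J I tgt a)
  contMDiff_one : ContMDiff I J ∞ one
  contMDiff_inv : ContMDiff J J ∞ inv
  contMDiffOn_mul : ∀ μ : A × A → A, (∀ a b (h : src a = tgt b), μ (a, b) = mul a b h) →
    ContMDiffOn (J.prod J) J ∞ μ {p | src p.1 = tgt p.2}

/-- A base-preserving morphism of Lie groupoids over `M`: a smooth map of the manifolds of arrows
which commutes with sources and targets and preserves products (hence units and inverses). -/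
structure LieGroupoid.BaseHom {I : ModelWithCorners ℝ EM HM} {M : Type*} [TopologicalSpace M]
    [ChartedSpace HM M] [IsManifold I ∞ M] {J : ModelWithCorners ℝ EA HA} {A : Type*}
    [TopologicalSpace A] [ChartedSpace HA A] [IsManifold J ∞ A]
    {K : ModelWithCorners ℝ EB HB} {B : Type*}
    [TopologicalSpace B] [ChartedSpace HB B] [IsManifold K ∞ B]
    (𝒜 : LieGroupoid I M J A) (ℬ : LieGroupoid I M K B) where
  toFun : A → B
  contMDiff_toFun : ContMDiff J K ∞ toFun
  src_toFun : ∀ a, ℬ.src (toFun a) = 𝒜.src a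
  tgt_toFun : ∀ a, ℬ.tgt (toFun a) = 𝒜.tgt a
  map_mul : ∀ a b (h : 𝒜.src a = 𝒜.tgt b),
    toFun (𝒜.mul a b h) = ℬ.mul (toFun a) (toFun b)
      ((src_toFun a).trans (h.trans (tgt_toFun b).symm))

/-- A map which has a smooth local section through `a` has surjective derivative at `a`. -/
theorem surjective_mfderiv_of_section {I : ModelWithCorners ℝ EM HM} {M : Type*}
    [TopologicalSpace M] [ChartedSpace HM M] {J : ModelWithCorners ℝ EA HA} {A : Type*}
    [TopologicalSpace A] [ChartedSpace HA A] {f : A → M} (hf : ContMDiff J I ∞ f) {a : A}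
    {σ : M → A} (hσ : ContMDiffAt I J ∞ σ (f a)) (ha : σ (f a) = a)
    (h : ∀ᶠ x in 𝓝 (f a), f (σ x) = x) : Surjective (mfderiv J I f a) := by
  have h1 : MDifferentiableAt J I f (σ (f a)) := hf.contMDiffAt.mdifferentiableAt (by simp)
  have h2 : MDifferentiableAt I J σ (f a) := hσ.mdifferentiableAt (by simp)
  have h3 := mfderiv_comp (f a) h1 h2
  have h4 : mfderiv I I (f ∘ σ) (f a) = mfderiv I I id (f a) :=
    Filter.EventuallyEq.mfderiv_eq h
  rw [h4, mfderiv_id] at h3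
  intro v
  have h5 : v = mfderiv J I f (σ (f a)) (mfderiv I J σ (f a) v) := 
    congrArg (fun L : EM →L[ℝ] EM => L v) h3
  rw [ha] at h5
  exact ⟨_, h5.symm⟩

end LieGroupoid

/-! ### The action groupoid -/

section ActionGroupoid

variable {EG HG : Type*} [NormedAddCommGroup EG] [NormedSpace ℝ EG] [TopologicalSpace HG]
  (IG : ModelWithCorners ℝ EG HG) (G : Type*) [TopologicalSpace G] [ChartedSpace HG G] [Group G]
  [LieGroup IG ∞ G]
  {EM HM : Type*} [NormedAddCommGroup EM] [NormedSpace ℝ EM] [TopologicalSpace HM]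
  (I : ModelWithCorners ℝ EM HM) (M : Type*) [TopologicalSpace M] [ChartedSpace HM M]
  [IsManifold I ∞ M] [MulAction G M] [ContMDiffSMul IG I ∞ G M]

instance isManifold_lieGroup_prod : IsManifold (IG.prod I) ∞ (G × M) :=
  haveI : IsManifold IG ∞ G := LieGroup.toContMDiffMul.toIsManifold
  inferInstance

/-- The action groupoid of a smooth action of the Lie group `G` on `M`: the manifold `G × M`, with
source `(g, m) ↦ m`, target `(g, m) ↦ g • m` and product `(g₁, m₁) (g₂, m₂) = (g₁ g₂, m₂)` when
`m₁ = g₂ • m₂`. -/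
def actionGroupoid : LieGroupoid I M (IG.prod I) (G × M) where
  src a := a.2
  tgt a := a.1 • a.2
  one x := (1, x)
  inv a := (a.1⁻¹, a.1 • a.2)
  mul a b _ := (a.1 * b.1, b.2)
  src_one _ := rfl
  tgt_one x := one_smul G x
  src_inv _ := rfl
  tgt_inv a := inv_smul_smul a.1 a.2
  src_mul _ _ _ := rfl
  tgt_mul a b h := by rw [h, mul_smul]
  mul_assoc a b c _ _ := by simp only [_root_.mul_assoc]
  one_mul a := by simp
  mul_one a := by simp
  inv_mul a := by simp
  mul_inv a := by simp
  contMDiff_src := contMDiff_snd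
  contMDiff_tgt := ContMDiffSMul.contMDiff_smul
  submersion_src a := surjective_mfderiv_of_section contMDiff_snd (σ := fun x => (a.1, x))
    (contMDiff_const.prodMk contMDiff_id).contMDiffAt rfl (Filter.Eventually.of_forall fun _ => rfl)
  submersion_tgt a := surjective_mfderiv_of_section ContMDiffSMul.contMDiff_smul
    (σ := fun x => (a.1, a.1⁻¹ • x))
    (contMDiff_const.prodMk ((ContMDiffSMul.contMDiff_smul (I := IG) (I' := I) (G := G) (M := M)).comp
      (contMDiff_const.prodMk contMDiff_id))).contMDiffAt
    (by simp) (Filter.Eventually.of_forall fun x => smul_inv_smul a.1 x)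
  contMDiff_one := contMDiff_const.prodMk contMDiff_id
  contMDiff_inv := ((contMDiff_inv IG ∞).comp contMDiff_fst).prodMk ContMDiffSMul.contMDiff_smul
  contMDiffOn_mul μ hμ := by
    have h : ContMDiff ((IG.prod I).prod (IG.prod I)) (IG.prod I) ∞
        (fun p : (G × M) × (G × M) => (p.1.1 * p.2.1, p.2.2)) :=
      ((contMDiff_fst.comp contMDiff_fst).mul (contMDiff_fst.comp contMDiff_snd)).prodMk
        (contMDiff_snd.comp contMDiff_snd)
    exact h.contMDiffOn.congr fun p hp => hμ p.1 p.2 hp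

end ActionGroupoid

/-! ### The Lie groupoid of linear isomorphisms between fibres -/

section PullbackFiber

variable {M N : Type*} (f : N → M) (V : M → Type*)

instance pullbackAddCommGroup [∀ x, AddCommGroup (V x)] (p : N) : AddCommGroup ((f *ᵖ V) p) :=
  inferInstanceAs (AddCommGroup (V (f p)))

instance pullbackIsTopologicalAddGroup [∀ x, AddCommGroup (V x)] [∀ x, TopologicalSpace (V x)]
    [∀ x, IsTopologicalAddGroup (V x)] (p : N) : IsTopologicalAddGroup ((f *ᵖ V) p) :=
  inferInstanceAs (IsTopologicalAddGroup (V (f p)))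

instance pullbackContinuousSMul [∀ x, AddCommGroup (V x)] [∀ x, Module ℝ (V x)]
    [∀ x, TopologicalSpace (V x)] [∀ x, ContinuousSMul ℝ (V x)] (p : N) :
    ContinuousSMul ℝ ((f *ᵖ V) p) :=
  inferInstanceAs (ContinuousSMul ℝ (V (f p)))

/-- The identification of two equal fibres. -/
def fibreCast {M : Type*} {V : M → Type*} [∀ x, AddCommGroup (V x)] [∀ x, Module ℝ (V x)]
    [∀ x, TopologicalSpace (V x)] {x y : M} (h : x = y) : V x →L[ℝ] V y :=
  h ▸ ContinuousLinearMap.id ℝ (V x)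

theorem fibreCast_rfl {M : Type*} {V : M → Type*} [∀ x, AddCommGroup (V x)] [∀ x, Module ℝ (V x)]
    [∀ x, TopologicalSpace (V x)] (x : M) :
    fibreCast (V := V) (rfl : x = x) = ContinuousLinearMap.id ℝ (V x) := rfl

theorem isInvertible_fibreCast {M : Type*} {V : M → Type*} [∀ x, AddCommGroup (V x)]
    [∀ x, Module ℝ (V x)] [∀ x, TopologicalSpace (V x)] {x y : M} (h : x = y) :
    (fibreCast (V := V) h).IsInvertible := by
  subst h
  exact ⟨ContinuousLinearEquiv.refl ℝ _, rfl⟩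

end PullbackFiber

section Coordinates

open ContinuousLinearMap

variable {M : Type*} [TopologicalSpace M] {F : Type*} [NormedAddCommGroup F] [NormedSpace ℝ F]
  {V : M → Type*} [TopologicalSpace (TotalSpace F V)] [∀ x, AddCommGroup (V x)]
  [∀ x, Module ℝ (V x)] [∀ x, TopologicalSpace (V x)] [FiberBundle F V]

theorem continuousLinearMapAt_pullback {N K : Type*} [TopologicalSpace N] [FunLike K N M]
    [ContinuousMapClass K N M] (f : K)
    (e : Trivialization F (π F V)) [e.IsLinear ℝ] (p : N) (v : V (f p)) :
    (e.pullback f).continuousLinearMapAt ℝ p v = e.continuousLinearMapAt ℝ (f p) v := by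
  classical
  simp only [Trivialization.continuousLinearMapAt_apply, Trivialization.coe_linearMapAt]
  rfl

theorem symmL_pullback {N K : Type*} [TopologicalSpace N] [FunLike K N M]
    [ContinuousMapClass K N M] (f : K)
    (e : Trivialization F (π F V)) [e.IsLinear ℝ] (p : N) (v : F) :
    (e.pullback f).symmL ℝ p v = e.symmL ℝ (f p) v := by
  by_cases h : f p ∈ e.baseSet
  · have h' : p ∈ (e.pullback f).baseSet := h
    have := (e.pullback f).symmL_apply (R := ℝ) h' v
    rw [this, e.symmL_apply h]
    exact (e.pullback f).symm_apply h' v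
  · rw [e.symmL_apply_of_notMem h]
    exact (e.pullback f).symmL_apply_of_notMem h v

variable [VectorBundle ℝ F V]

theorem isInvertible_inCoordinates {x₀ x y₀ y : M}
    (hx : x ∈ (trivializationAt F V x₀).baseSet) (hy : y ∈ (trivializationAt F V y₀).baseSet)
    (A : V x →L[ℝ] V y) :
    (inCoordinates F V F V x₀ x y₀ y A).IsInvertible ↔ A.IsInvertible := by
  rw [inCoordinates_eq hx hy]
  simp

theorem inCoordinates_comp {x₀ x y₀ y z₀ z : M}
    (hy : y ∈ (trivializationAt F V y₀).baseSet) (B : V y →L[ℝ] V z) (A : V x →L[ℝ] V y) :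
    inCoordinates F V F V x₀ x z₀ z (B.comp A) =
      (inCoordinates F V F V y₀ y z₀ z B).comp (inCoordinates F V F V x₀ x y₀ y A) := by
  ext v
  simp only [inCoordinates, ContinuousLinearMap.comp_apply,
    Trivialization.symmL_continuousLinearMapAt _ hy]

theorem inCoordinates_comp_cast {x₀ x y₀ y y₀' y' z₀ z : M} (h₀ : y₀' = y₀) (h : y' = y)
    (hy : y ∈ (trivializationAt F V y₀).baseSet) (B : V y' →L[ℝ] V z) (A : V x →L[ℝ] V y) :
    inCoordinates F V F V x₀ x z₀ z ((B.comp (fibreCast h.symm)).comp A) =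
      (inCoordinates F V F V y₀' y' z₀ z B).comp (inCoordinates F V F V x₀ x y₀ y A) := by
  subst h₀ h
  exact inCoordinates_comp hy B A

theorem inCoordinates_id {x₀ x : M} (hx : x ∈ (trivializationAt F V x₀).baseSet) :
    inCoordinates F V F V x₀ x x₀ x (ContinuousLinearMap.id ℝ (V x)) =
      ContinuousLinearMap.id ℝ F := by
  ext v
  simp [inCoordinates, Trivialization.continuousLinearMapAt_symmL _ hx]

theorem inCoordinates_inverse {x₀ x y₀ y : M}
    (hx : x ∈ (trivializationAt F V x₀).baseSet) (hy : y ∈ (trivializationAt F V y₀).baseSet)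
    (A : V x →L[ℝ] V y) :
    inCoordinates F V F V y₀ y x₀ x A.inverse = (inCoordinates F V F V x₀ x y₀ y A).inverse := by
  rw [inCoordinates_eq hx hy, inCoordinates_eq hy hx]
  simp [ContinuousLinearMap.comp_assoc]

end Coordinates

set_option linter.unusedSectionVars false

section FrameGroupoid

open ContinuousLinearMap

variable {EM HM M : Type*} [NormedAddCommGroup EM] [NormedSpace ℝ EM] [TopologicalSpace HM]
  (I : ModelWithCorners ℝ EM HM) [TopologicalSpace M] [ChartedSpace HM M]
  (F : Type*) [NormedAddCommGroup F] [NormedSpace ℝ F]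
  (V : M → Type*) [TopologicalSpace (TotalSpace F V)] [∀ x, AddCommGroup (V x)]
  [∀ x, Module ℝ (V x)] [∀ x, TopologicalSpace (V x)]
  [∀ x, IsTopologicalAddGroup (V x)] [∀ x, ContinuousSMul ℝ (V x)]
  [FiberBundle F V] [VectorBundle ℝ F V] [ContMDiffVectorBundle ∞ F V I]

/-- The fibre `V x →L[ℝ] V y` over `(x, y)` of the vector bundle `Hom(pr₁^* V, pr₂^* V)` over
`M × M`. -/
abbrev LinFiber (p : M × M) : Type _ :=
  ((ContMDiffMap.fst : C^∞⟮I.prod I, M × M; I, M⟯) *ᵖ V) p →L[ℝ]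
    ((ContMDiffMap.snd : C^∞⟮I.prod I, M × M; I, M⟯) *ᵖ V) p

/-- The total space of `Hom(pr₁^* V, pr₂^* V)`: the manifold of all linear maps from a fibre of `V`
to some fibre of `V`, locally identified with `M × M × (F →L[ℝ] F)`. -/
abbrev LinTotal : Type _ := TotalSpace (F →L[ℝ] F) (LinFiber I V)

variable {I F V}

/-- The linear map underlying an element of the total space. -/
def LinTotal.lin (a : LinTotal I F V) : V a.1.1 →L[ℝ] V a.1.2 := a.2

/-- The element of the total space given by a linear map between two fibres. -/
def LinTotal.mk {x y : M} (A : V x →L[ℝ] V y) : LinTotal I F V := ⟨(x, y), A⟩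

theorem inCoordinates_pullback (p₀ p : M × M) (A : LinFiber I V p) :
    inCoordinates F ((ContMDiffMap.fst : C^∞⟮I.prod I, M × M; I, M⟯) *ᵖ V)
      F ((ContMDiffMap.snd : C^∞⟮I.prod I, M × M; I, M⟯) *ᵖ V) p₀ p p₀ p A =
    inCoordinates F V F V p₀.1 p.1 p₀.2 p.2 A := by
  ext v
  refine (continuousLinearMapAt_pullback (ContMDiffMap.snd : C^∞⟮I.prod I, M × M; I, M⟯)
    (trivializationAt F V p₀.2) p _).trans ?_
  exact congrArg (fun w => (trivializationAt F V p₀.2).continuousLinearMapAt ℝ p.2 (A w))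
    (symmL_pullback (ContMDiffMap.fst : C^∞⟮I.prod I, M × M; I, M⟯)
      (trivializationAt F V p₀.1) p v)

theorem contMDiffWithinAt_lin {EN HN N : Type*} [NormedAddCommGroup EN] [NormedSpace ℝ EN]
    [TopologicalSpace HN] {J : ModelWithCorners ℝ EN HN} [TopologicalSpace N] [ChartedSpace HN N]
    {f : N → LinTotal I F V} {s : Set N} {z : N} :
    ContMDiffWithinAt J ((I.prod I).prod 𝓘(ℝ, F →L[ℝ] F)) ∞ f s z ↔
      ContMDiffWithinAt J (I.prod I) ∞ (fun w => (f w).1) s z ∧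
      ContMDiffWithinAt J 𝓘(ℝ, F →L[ℝ] F) ∞ (fun w =>
        inCoordinates F V F V (f z).1.1 (f w).1.1 (f z).1.2 (f w).1.2 (f w).lin) s z :=
  (contMDiffWithinAt_hom_bundle f).trans (by
    simp only [inCoordinates_pullback]
    rfl)

theorem eventually_mem_baseSet {N : Type*} [TopologicalSpace N] {f : N → M} {s : Set N} {z : N}
    (hf : ContinuousWithinAt f s z) :
    ∀ᶠ w in 𝓝[s] z, f w ∈ (trivializationAt F V (f z)).baseSet :=
  hf.eventually ((trivializationAt F V (f z)).open_baseSet.mem_nhds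
    (mem_baseSet_trivializationAt F V _))

variable (I F V) [FiniteDimensional ℝ F]

/-- The open set of linear isomorphisms in the manifold of linear maps between fibres. -/
def linIso : TopologicalSpace.Opens (LinTotal I F V) where
  carrier := {a | a.lin.IsInvertible}
  is_open' := by
    have : CompleteSpace F := FiniteDimensional.complete ℝ F
    rw [isOpen_iff_mem_nhds]
    intro a ha
    have hc := ((contMDiffWithinAt_lin (f := (id : LinTotal I F V → LinTotal I F V)) (s := univ)
      (z := a) (J := (I.prod I).prod 𝓘(ℝ, F →L[ℝ] F))).1
      contMDiffWithinAt_id).2.continuousWithinAt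
    have hp := (FiberBundle.continuous_proj (F →L[ℝ] F) (LinFiber I V)).continuousWithinAt
      (s := univ) (x := a)
    have h1 := eventually_mem_baseSet (F := F) (V := V) hp.fst
    have h2 := eventually_mem_baseSet (F := F) (V := V) hp.snd
    have h3 : IsOpen {L : F →L[ℝ] F | L.IsInvertible} := ContinuousLinearEquiv.isOpen
    have h4 := hc.eventually (h3.mem_nhds ((isInvertible_inCoordinates
      (mem_baseSet_trivializationAt F V _) (mem_baseSet_trivializationAt F V _) _).2 ha))
    rw [nhdsWithin_univ] at h1 h2 h4
    filter_upwards [h1, h2, h4] with b h1 h2 h4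
    exact (isInvertible_inCoordinates h1 h2 _).1 h4

/-- The manifold `Φ(V)` of all linear isomorphisms from a fibre of `V` to some fibre of `V`; it is
locally identified with `M × M × GL(F)`. -/
abbrev FrameArrow : Type _ := linIso I F V

variable {I F V}

namespace FrameArrow

/-- The fibre over `a.src` is the domain of `a`. -/
def src (a : FrameArrow I F V) : M := a.1.1.1

/-- The fibre over `a.tgt` is the codomain of `a`. -/
def tgt (a : FrameArrow I F V) : M := a.1.1.2

/-- The linear isomorphism underlying an arrow. -/
def lin (a : FrameArrow I F V) : V a.src →L[ℝ] V a.tgt := a.1.lin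

theorem isInvertible_lin (a : FrameArrow I F V) : a.lin.IsInvertible := a.2

/-- The arrow given by a linear isomorphism between two fibres. -/
def mk {x y : M} (A : V x →L[ℝ] V y) (hA : A.IsInvertible) : FrameArrow I F V :=
  ⟨LinTotal.mk A, hA⟩

/-- Composition of linear isomorphisms. -/
def comp (a b : FrameArrow I F V) (h : a.src = b.tgt) : FrameArrow I F V :=
  mk ((a.lin.comp (fibreCast h.symm)).comp b.lin)
    ((a.isInvertible_lin.comp (isInvertible_fibreCast h.symm)).comp b.isInvertible_lin)

/-- The identity of a fibre. -/
def one (x : M) : FrameArrow I F V :=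
  mk (ContinuousLinearMap.id ℝ (V x)) ⟨ContinuousLinearEquiv.refl ℝ _, rfl⟩

/-- The inverse of a linear isomorphism. -/
def inv (a : FrameArrow I F V) : FrameArrow I F V := mk a.lin.inverse a.isInvertible_lin.inverse

theorem contMDiffWithinAt_iff {EN HN N : Type*} [NormedAddCommGroup EN] [NormedSpace ℝ EN]
    [TopologicalSpace HN] {J : ModelWithCorners ℝ EN HN} [TopologicalSpace N] [ChartedSpace HN N]
    {f : N → FrameArrow I F V} {s : Set N} {z : N} :
    ContMDiffWithinAt J ((I.prod I).prod 𝓘(ℝ, F →L[ℝ] F)) ∞ f s z ↔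
      ContMDiffWithinAt J I ∞ (fun w => (f w).src) s z ∧
      ContMDiffWithinAt J I ∞ (fun w => (f w).tgt) s z ∧
      ContMDiffWithinAt J 𝓘(ℝ, F →L[ℝ] F) ∞ (fun w =>
        inCoordinates F V F V (f z).src (f w).src (f z).tgt (f w).tgt (f w).lin) s z := by
  rw [← ContMDiffWithinAt.subtypeVal_comp_iff, contMDiffWithinAt_lin, ← and_assoc]
  refine and_congr ⟨fun h => ⟨contMDiffAt_fst.comp_contMDiffWithinAt _ h,
    contMDiffAt_snd.comp_contMDiffWithinAt _ h⟩, fun h => h.1.prodMk h.2⟩ Iff.rfl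

theorem contMDiff_src :
    ContMDiff ((I.prod I).prod 𝓘(ℝ, F →L[ℝ] F)) I ∞ (src : FrameArrow I F V → M) := fun a =>
  (contMDiffWithinAt_iff.1 (contMDiffWithinAt_id (x := a))).1

theorem contMDiff_tgt :
    ContMDiff ((I.prod I).prod 𝓘(ℝ, F →L[ℝ] F)) I ∞ (tgt : FrameArrow I F V → M) := fun a =>
  (contMDiffWithinAt_iff.1 (contMDiffWithinAt_id (x := a))).2.1

theorem contMDiff_one :
    ContMDiff I ((I.prod I).prod 𝓘(ℝ, F →L[ℝ] F)) ∞ (one : M → FrameArrow I F V) := fun x => by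
  refine contMDiffWithinAt_iff.2 ⟨contMDiffWithinAt_id, contMDiffWithinAt_id, ?_⟩
  refine (contMDiffWithinAt_const (c := ContinuousLinearMap.id ℝ F)).congr_of_eventuallyEq_of_mem
    ?_ (mem_univ _)
  filter_upwards [eventually_mem_baseSet (F := F) (V := V)
    (continuous_id.continuousWithinAt (s := univ) (x := x))] with w hw
  exact inCoordinates_id hw

theorem contMDiff_inv : ContMDiff ((I.prod I).prod 𝓘(ℝ, F →L[ℝ] F))
    ((I.prod I).prod 𝓘(ℝ, F →L[ℝ] F)) ∞ (inv : FrameArrow I F V → FrameArrow I F V) := fun a => by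
  have : CompleteSpace F := FiniteDimensional.complete ℝ F
  have h := contMDiffWithinAt_iff.1 (contMDiffWithinAt_id (s := univ) (x := a)
    (I := (I.prod I).prod 𝓘(ℝ, F →L[ℝ] F)) (n := ∞))
  refine contMDiffWithinAt_iff.2 ⟨h.2.1, h.1, ?_⟩
  have h1 := (isInvertible_inCoordinates (mem_baseSet_trivializationAt F V a.src)
    (mem_baseSet_trivializationAt F V a.tgt) a.lin).2 a.isInvertible_lin
  have h2 := (h1.contDiffAt_map_inverse (n := ∞)).contMDiffAt.comp_contMDiffWithinAt a h.2.2
  refine h2.congr_of_eventuallyEq_of_mem ?_ (mem_univ _)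
  filter_upwards [eventually_mem_baseSet (F := F) (V := V) h.1.continuousWithinAt,
    eventually_mem_baseSet (F := F) (V := V) h.2.1.continuousWithinAt] with w hw1 hw2
  exact inCoordinates_inverse hw1 hw2 w.lin

theorem contMDiffOn_comp (μ : FrameArrow I F V × FrameArrow I F V → FrameArrow I F V)
    (hμ : ∀ a b (h : a.src = b.tgt), μ (a, b) = comp a b h) :
    ContMDiffOn (((I.prod I).prod 𝓘(ℝ, F →L[ℝ] F)).prod ((I.prod I).prod 𝓘(ℝ, F →L[ℝ] F)))
      ((I.prod I).prod 𝓘(ℝ, F →L[ℝ] F)) ∞ μ {p | p.1.src = p.2.tgt} := by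
  rintro ⟨a, b⟩ hab
  have ha := contMDiffWithinAt_iff.1 (contMDiffWithinAt_fst (I := (I.prod I).prod 𝓘(ℝ, F →L[ℝ] F))
    (J := (I.prod I).prod 𝓘(ℝ, F →L[ℝ] F)) (n := ∞) (M := FrameArrow I F V)
    (N := FrameArrow I F V) (s := {p | p.1.src = p.2.tgt}) (p := (a, b)))
  have hb := contMDiffWithinAt_iff.1 (contMDiffWithinAt_snd (I := (I.prod I).prod 𝓘(ℝ, F →L[ℝ] F))
    (J := (I.prod I).prod 𝓘(ℝ, F →L[ℝ] F)) (n := ∞) (M := FrameArrow I F V)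
    (N := FrameArrow I F V) (s := {p | p.1.src = p.2.tgt}) (p := (a, b)))
  have key : ∀ p ∈ {p : FrameArrow I F V × FrameArrow I F V | p.1.src = p.2.tgt},
      (μ p).src = p.2.src ∧ (μ p).tgt = p.1.tgt := fun p hp => by
    rw [show μ p = comp p.1 p.2 hp from hμ p.1 p.2 hp]
    exact ⟨rfl, rfl⟩
  refine contMDiffWithinAt_iff.2 ⟨hb.1.congr_of_mem (fun p hp => (key p hp).1) hab,
    ha.2.1.congr_of_mem (fun p hp => (key p hp).2) hab, ?_⟩
  refine (ha.2.2.clm_comp hb.2.2).congr_of_eventuallyEq_of_mem ?_ hab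
  filter_upwards [eventually_mem_baseSet (F := F) (V := V) hb.2.1.continuousWithinAt,
    self_mem_nhdsWithin] with p hp1 hp2
  rw [show μ p = comp p.1 p.2 hp2 from hμ p.1 p.2 hp2,
    show μ (a, b) = comp a b hab from hμ a b hab]
  exact inCoordinates_comp_cast hab hp2 hp1 p.1.lin p.2.lin

theorem exists_section (a : FrameArrow I F V) : ∃ σ : M → FrameArrow I F V,
    ContMDiffAt I ((I.prod I).prod 𝓘(ℝ, F →L[ℝ] F)) ∞ σ a.src ∧ σ a.src = a ∧
      ∀ᶠ x in 𝓝 a.src, (σ x).src = x := by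
  classical
  set e := trivializationAt F V a.src with he
  have hmem : a.src ∈ e.baseSet := mem_baseSet_trivializationAt F V a.src
  have hinv : ∀ x ∈ e.baseSet,
      ((e.symmL ℝ a.src).comp (e.continuousLinearMapAt ℝ x)).IsInvertible := fun x hx =>
    ⟨(e.continuousLinearEquivAt ℝ x hx).trans (e.continuousLinearEquivAt ℝ a.src hmem).symm, by
      ext v
      simp [e.symmL_apply hmem, hx]⟩
  let σ : M → FrameArrow I F V := fun x =>
    if hx : x ∈ e.baseSet then
      mk (a.lin.comp ((e.symmL ℝ a.src).comp (e.continuousLinearMapAt ℝ x)))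
        (a.isInvertible_lin.comp (hinv x hx))
    else a
  have hσ : ∀ x (hx : x ∈ e.baseSet), σ x =
      mk (a.lin.comp ((e.symmL ℝ a.src).comp (e.continuousLinearMapAt ℝ x)))
        (a.isInvertible_lin.comp (hinv x hx)) := fun x hx => dif_pos hx
  have hev : ∀ᶠ x in 𝓝 a.src, x ∈ e.baseSet := e.open_baseSet.mem_nhds hmem
  have ha : σ a.src = a := by
    rw [hσ _ hmem]
    refine Subtype.ext ?_
    have : (e.symmL ℝ a.src).comp (e.continuousLinearMapAt ℝ a.src) =
        ContinuousLinearMap.id ℝ (V a.src) := by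
      ext v
      exact e.symmL_continuousLinearMapAt hmem v
    exact congrArg (fun L => LinTotal.mk (I := I) (F := F) (a.lin.comp L)) this
  refine ⟨σ, ?_, ha, hev.mono fun x hx => by rw [hσ x hx]; rfl⟩
  refine contMDiffWithinAt_iff.2 ⟨?_, ?_, ?_⟩
  · refine contMDiffAt_id.congr_of_eventuallyEq (hev.mono fun x hx => ?_)
    beta_reduce
    rw [hσ x hx]
    rfl
  · refine (contMDiffAt_const (c := a.tgt)).congr_of_eventuallyEq (hev.mono fun x hx => ?_)
    beta_reduce
    rw [hσ x hx]
    rfl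
  · refine (contMDiffAt_const (c := inCoordinates F V F V a.src a.src a.tgt a.tgt
      a.lin)).congr_of_eventuallyEq (hev.mono fun x hx => ?_)
    beta_reduce
    rw [ha, hσ x hx]
    ext v
    change (trivializationAt F V a.tgt).continuousLinearMapAt ℝ a.tgt (a.lin (e.symmL ℝ a.src
      (e.continuousLinearMapAt ℝ x (e.symmL ℝ x v)))) = _
    rw [e.continuousLinearMapAt_symmL hx]
    rfl

end FrameArrow

/-- The image `a (ψ (src a))`, in the fibre over `tgt a`, of the value of a section under `a`. -/
def FrameArrow.apply (a : FrameArrow I F V) (ψ : Cₛ^∞⟮I; F, V⟯) : TotalSpace F V :=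
  ⟨a.tgt, a.lin (ψ a.src)⟩

variable (I F V) [IsManifold I ∞ M]

/-- The Lie groupoid `Φ(V)` with base `M`: its arrows are the linear isomorphisms from a fibre of
`V` to some fibre of `V`, with the composition of maps. -/
def frameGroupoid : LieGroupoid I M ((I.prod I).prod 𝓘(ℝ, F →L[ℝ] F)) (FrameArrow I F V) where
  src := FrameArrow.src
  tgt := FrameArrow.tgt
  one := FrameArrow.one
  inv := FrameArrow.inv
  mul := FrameArrow.comp
  src_one _ := rfl
  tgt_one _ := rfl
  src_inv _ := rfl
  tgt_inv _ := rfl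
  src_mul _ _ _ := rfl
  tgt_mul _ _ _ := rfl
  mul_assoc := by
    rintro ⟨⟨⟨x, y⟩, A⟩, hA⟩ ⟨⟨⟨x', y'⟩, B⟩, hB⟩ ⟨⟨⟨x'', y''⟩, C⟩, hC⟩ h h'
    obtain rfl : x = y' := h
    obtain rfl : x' = y'' := h'
    rfl
  one_mul a := rfl
  mul_one a := rfl
  inv_mul a := by
    refine Subtype.ext (congrArg (LinTotal.mk (I := I) (F := F)) ?_)
    exact a.isInvertible_lin.inverse_comp_self
  mul_inv a := by
    refine Subtype.ext (congrArg (LinTotal.mk (I := I) (F := F)) ?_)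
    exact a.isInvertible_lin.self_comp_inverse
  contMDiff_src := FrameArrow.contMDiff_src
  contMDiff_tgt := FrameArrow.contMDiff_tgt
  submersion_src a := by
    obtain ⟨σ, h1, h2, h3⟩ := FrameArrow.exists_section a
    exact surjective_mfderiv_of_section FrameArrow.contMDiff_src h1 h2 h3
  submersion_tgt a := by
    obtain ⟨σ, h1, h2, h3⟩ := (FrameArrow.inv a).exists_section
    refine surjective_mfderiv_of_section FrameArrow.contMDiff_tgt
      (σ := fun x => FrameArrow.inv (σ x))
      ((FrameArrow.contMDiff_inv (I := I) (F := F) (V := V)).contMDiffAt.comp (FrameArrow.tgt a) h1)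
      ?_ h3
    change FrameArrow.inv (σ (FrameArrow.src (FrameArrow.inv a))) = a
    rw [h2]
    exact Subtype.ext (congrArg (LinTotal.mk (I := I) (F := F)) a.isInvertible_lin.inverse_inverse)
  contMDiff_one := FrameArrow.contMDiff_one
  contMDiff_inv := FrameArrow.contMDiff_inv
  contMDiffOn_mul := FrameArrow.contMDiffOn_comp

/-- A representation of a Lie groupoid with base `M` on the vector bundle `V`: a base-preserving
morphism of Lie groupoids to `Φ(V)`. -/
abbrev GroupoidRepresentation {I : ModelWithCorners ℝ EM HM} {EA HA A : Type*}
    [NormedAddCommGroup EA] [NormedSpace ℝ EA] [TopologicalSpace HA]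
    {J : ModelWithCorners ℝ EA HA} [TopologicalSpace A] [ChartedSpace HA A] [IsManifold J ∞ A]
    [IsManifold I ∞ M] (𝒜 : LieGroupoid I M J A)
    (F : Type*) [NormedAddCommGroup F] [NormedSpace ℝ F]
    (V : M → Type*) [TopologicalSpace (TotalSpace F V)] [∀ x, AddCommGroup (V x)]
    [∀ x, Module ℝ (V x)] [∀ x, TopologicalSpace (V x)]
    [∀ x, IsTopologicalAddGroup (V x)] [∀ x, ContinuousSMul ℝ (V x)]
    [FiberBundle F V] [VectorBundle ℝ F V] [ContMDiffVectorBundle ∞ F V I]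
    [FiniteDimensional ℝ F] : Type _ :=
  LieGroupoid.BaseHom 𝒜 (frameGroupoid I F V)

end FrameGroupoid

/-! ### Semi-linear isomorphisms and semi-linear representations -/

section Semilinear

variable {EM HM M : Type*} [NormedAddCommGroup EM] [NormedSpace ℝ EM] [TopologicalSpace HM]
  (I : ModelWithCorners ℝ EM HM) [TopologicalSpace M] [ChartedSpace HM M]
  (F : Type*) [NormedAddCommGroup F] [NormedSpace ℝ F]
  (V : M → Type*) [TopologicalSpace (TotalSpace F V)] [∀ x, AddCommGroup (V x)]
  [∀ x, Module ℝ (V x)] [∀ x, TopologicalSpace (V x)]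
  [FiberBundle F V] [VectorBundle ℝ F V] [ContMDiffVectorBundle ∞ F V I]

variable {I F V} in
/-- The product `f ψ` of a smooth function and a smooth section. -/
def funSMul (f : C^∞⟮I, M; ℝ⟯) (ψ : Cₛ^∞⟮I; F, V⟯) : Cₛ^∞⟮I; F, V⟯ :=
  ⟨fun x => f x • ψ x, f.contMDiff.smul_section ψ.contMDiff⟩

variable {I F V} in
/-- The semi-linearity identity `μ (f ψ) = μM f · μ ψ`. -/
def IsSemilinearOver (μ : Cₛ^∞⟮I; F, V⟯ ≃ₗ[ℝ] Cₛ^∞⟮I; F, V⟯)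
    (μM : C^∞⟮I, M; ℝ⟯ ≃ₗ[ℝ] C^∞⟮I, M; ℝ⟯) : Prop :=
  ∀ (f : C^∞⟮I, M; ℝ⟯) (ψ : Cₛ^∞⟮I; F, V⟯), μ (funSMul f ψ) = funSMul (μM f) (μ ψ)

/-- The group of semi-linear isomorphisms of the space of smooth sections of `V`: the linear
automorphisms `μ` for which there is some linear automorphism `μM` of `C^∞(M)` with
`μ (f ψ) = μM f · μ ψ`. -/
def semilinearIso : Subgroup (Cₛ^∞⟮I; F, V⟯ ≃ₗ[ℝ] Cₛ^∞⟮I; F, V⟯) where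
  carrier := {μ | ∃ μM : C^∞⟮I, M; ℝ⟯ ≃ₗ[ℝ] C^∞⟮I, M; ℝ⟯, IsSemilinearOver μ μM}
  one_mem' := ⟨1, fun _ _ => rfl⟩
  mul_mem' := by
    rintro μ ν ⟨μM, hμ⟩ ⟨νM, hν⟩
    refine ⟨μM * νM, fun f ψ => ?_⟩
    change μ (ν (funSMul f ψ)) = funSMul (μM (νM f)) (μ (ν ψ))
    rw [hν, hμ]
  inv_mem' := by
    rintro μ ⟨μM, hμ⟩
    refine ⟨μM⁻¹, fun f ψ => ?_⟩
    change μ.symm (funSMul f ψ) = funSMul (μM.symm f) (μ.symm ψ)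
    rw [LinearEquiv.symm_apply_eq, hμ, LinearEquiv.apply_symm_apply, LinearEquiv.apply_symm_apply]

variable {EG HG : Type*} [NormedAddCommGroup EG] [NormedSpace ℝ EG] [TopologicalSpace HG]
  (IG : ModelWithCorners ℝ EG HG) (G : Type*) [TopologicalSpace G] [ChartedSpace HG G] [Group G]

/-- A semi-linear representation of `G` on `V`: a group morphism from `G` to the group of
semi-linear isomorphisms of the sections of `V` such that `(g, m) ↦ R g ψ m`, `G × M → V`, is
smooth for every section `ψ`. -/
structure SemilinearRepresentation where
  hom : G →* semilinearIso I F V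
  contMDiff_hom : ∀ ψ : Cₛ^∞⟮I; F, V⟯, ContMDiff (IG.prod I) (I.prod 𝓘(ℝ, F)) ∞
    (fun p : G × M => TotalSpace.mk' F p.2 ((hom p.1 : Cₛ^∞⟮I; F, V⟯ ≃ₗ[ℝ] Cₛ^∞⟮I; F, V⟯) ψ p.2))

variable {I F V IG G}

/-- The section `R g ψ`. -/
def SemilinearRepresentation.act (R : SemilinearRepresentation I F V IG G) (g : G)
    (ψ : Cₛ^∞⟮I; F, V⟯) : Cₛ^∞⟮I; F, V⟯ :=
  (R.hom g : Cₛ^∞⟮I; F, V⟯ ≃ₗ[ℝ] Cₛ^∞⟮I; F, V⟯) ψ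

variable (IG I M) [MulAction G M] [ContMDiffSMul IG I ∞ G M]

/-- The composite `f ∘ g_M` of a smooth function with the action `g_M : m ↦ g • m` of `g`. -/
def compAction (g : G) (f : C^∞⟮I, M; ℝ⟯) : C^∞⟮I, M; ℝ⟯ :=
  ⟨fun m => f (g • m), f.contMDiff.comp
    ((ContMDiffSMul.contMDiff_smul (I := IG) (I' := I) (G := G) (M := M)).comp
      (contMDiff_const.prodMk contMDiff_id))⟩

/-- The linear automorphism `f ↦ f ∘ (g_M)⁻¹` of `C^∞(M)`. -/
def translate (g : G) : C^∞⟮I, M; ℝ⟯ ≃ₗ[ℝ] C^∞⟮I, M; ℝ⟯ where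
  toFun := compAction M I IG g⁻¹
  invFun := compAction M I IG g
  map_add' _ _ := rfl
  map_smul' _ _ := rfl
  left_inv f := ContMDiffMap.ext fun m => congrArg f (inv_smul_smul g m)
  right_inv f := ContMDiffMap.ext fun m => congrArg f (smul_inv_smul g m)

variable {IG I M}

/-- `R` is associated to the given action of `G` on `M`:
`R g (f ψ) = (f ∘ (g_M)⁻¹) · R g ψ` for all `g`, `f`, `ψ`. -/
def SemilinearRepresentation.IsAssociated (R : SemilinearRepresentation I F V IG G) : Prop :=
  ∀ g : G, IsSemilinearOver (R.hom g : Cₛ^∞⟮I; F, V⟯ ≃ₗ[ℝ] Cₛ^∞⟮I; F, V⟯) (translate M I IG g)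

end Semilinear

end

end GroupoidReps

/-! The identity can define `ρ` only if `(R g ψ) (g • m)` depends on `ψ m` alone, and this is the
one point that is not formal. Association to the action gives `(R g (f ψ)) (g • m) = f m • (R g ψ)
(g • m)`. If `ψ m = 0` and `χ` is a cutoff at `m`, then `χ² ψ` is a combination of globally defined
sections, obtained by cutting off a local frame, with coefficients vanishing at `m`
(`cutoff_smul_eq_sum`). Applying `R g` and evaluating at `g • m` gives zero (`act_eq_zero`). Every
vector is the value of a section (`exists_section_eq`), so `R g` induces linear maps `V m → V (g •
m)`, invertible by the same argument for `g⁻¹`. In trivializations their columns are `R g` applied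
to fixed sections, hence smooth in `(g, m)`.

Conversely, `ρ` yields `(R g ψ) m = ρ (g, g⁻¹ • m) (ψ (g⁻¹ • m))`. This is semi-linear because
arrows are linear on fibres, and smooth because an arrow applied to a section depends smoothly on
the arrow (`contMDiff_apply`). The constructions are mutually inverse because the identity
determines either side from the other: arrows are detected by sections (`FrameArrow.ext_apply`), and
every point has the form `g • m`. -/

namespace GroupoidReps

noncomputable section

set_option linter.unusedSectionVars false

/-! ### Cutoff functions and global extensions of local frames -/

section LocalExtension

variable {EM HM M : Type*} [NormedAddCommGroup EM] [NormedSpace ℝ EM] [FiniteDimensional ℝ EM]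
  [TopologicalSpace HM] (I : ModelWithCorners ℝ EM HM) [TopologicalSpace M] [ChartedSpace HM M]
  [IsManifold I ∞ M] [T2Space M]
  (F : Type*) [NormedAddCommGroup F] [NormedSpace ℝ F]
  (V : M → Type*) [TopologicalSpace (TotalSpace F V)] [∀ x, AddCommGroup (V x)]
  [∀ x, Module ℝ (V x)] [∀ x, TopologicalSpace (V x)] [FiberBundle F V] [VectorBundle ℝ F V]
  [ContMDiffVectorBundle ∞ F V I]

/-- There is a smooth function which is `1` near `m` and whose support is contained in a given
neighbourhood of `m`. -/
theorem exists_cutoff (m : M) {u : Set M} (hu : u ∈ 𝓝 m) :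
    ∃ χ : C^∞⟮I, M; ℝ⟯, tsupport χ ⊆ u ∧ ∀ᶠ y in 𝓝 m, χ y = 1 := by
  -- The basis is indexed by the bump functions with closed support in `u`; applying it to `univ`
  -- merely extracts one index.
  obtain ⟨f, hf, -⟩ := (SmoothBumpFunction.nhds_basis_support (I := I) hu).mem_iff.1
    (Filter.univ_mem (f := 𝓝 m))
  exact ⟨⟨f, f.contMDiff⟩, hf, f.eventuallyEq_one⟩

/-- A cutoff function at `m`, supported in the domain of the preferred trivialization at `m`. -/
def cutoff (m : M) : C^∞⟮I, M; ℝ⟯ :=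
  (exists_cutoff I m ((trivializationAt F V m).open_baseSet.mem_nhds
    (mem_baseSet_trivializationAt F V m))).choose

theorem tsupport_cutoff_subset (m : M) :
    tsupport (cutoff I F V m) ⊆ (trivializationAt F V m).baseSet :=
  (exists_cutoff I m ((trivializationAt F V m).open_baseSet.mem_nhds
    (mem_baseSet_trivializationAt F V m))).choose_spec.1

theorem cutoff_eventually_eq_one (m : M) : ∀ᶠ y in 𝓝 m, cutoff I F V m y = 1 :=
  (exists_cutoff I m ((trivializationAt F V m).open_baseSet.mem_nhds
    (mem_baseSet_trivializationAt F V m))).choose_spec.2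

theorem cutoff_self (m : M) : cutoff I F V m m = 1 :=
  (cutoff_eventually_eq_one I F V m).self_of_nhds

theorem cutoff_eq_zero {m x : M} (hx : x ∉ (trivializationAt F V m).baseSet) :
    cutoff I F V m x = 0 :=
  image_eq_zero_of_notMem_tsupport fun h => hx (tsupport_cutoff_subset I F V m h)

/-- Read in the trivialization itself, the section is the constant `v`. -/
theorem contMDiffOn_symmL (m : M) (v : F) :
    ContMDiffOn I (I.prod 𝓘(ℝ, F)) ∞
      (fun x => TotalSpace.mk' F x ((trivializationAt F V m).symmL ℝ x v))
      (trivializationAt F V m).baseSet := by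
  rw [Trivialization.contMDiffOn_section_baseSet_iff]
  refine (contMDiffOn_const (c := v)).congr fun y hy => ?_
  rw [← Trivialization.continuousLinearMapAt_apply_of_mem ℝ _ hy]
  exact (trivializationAt F V m).continuousLinearMapAt_symmL hy v

/-- The section which is constant, equal to `v`, near `m` in the preferred trivialization at `m`,
cut off away from `m`; it depends linearly on `v`. -/
def localExt (m : M) : F →ₗ[ℝ] Cₛ^∞⟮I; F, V⟯ where
  toFun v := ⟨⇑(cutoff I F V m) • fun x => (trivializationAt F V m).symmL ℝ x v,
    (cutoff I F V m).contMDiff.contMDiffOn.smul_section_of_tsupport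
      (trivializationAt F V m).open_baseSet (tsupport_cutoff_subset I F V m)
      (contMDiffOn_symmL I F V m v)⟩
  map_add' v w := by
    ext x
    refine (congrArg (cutoff I F V m x • ·)
      (map_add ((trivializationAt F V m).symmL ℝ x) v w)).trans ?_
    exact smul_add (cutoff I F V m x) ((trivializationAt F V m).symmL ℝ x v) _
  map_smul' c v := by
    ext x
    refine (congrArg (cutoff I F V m x • ·)
      (map_smul ((trivializationAt F V m).symmL ℝ x) c v)).trans ?_
    exact smul_comm (cutoff I F V m x) c ((trivializationAt F V m).symmL ℝ x v)

variable {I F V}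

theorem localExt_apply (m x : M) (v : F) :
    localExt I F V m v x = cutoff I F V m x • (trivializationAt F V m).symmL ℝ x v := rfl

theorem localExt_eventually_eq (m : M) :
    ∀ᶠ x in 𝓝 m, ∀ v, localExt I F V m v x = (trivializationAt F V m).symmL ℝ x v := by
  filter_upwards [cutoff_eventually_eq_one I F V m] with x hx v
  rw [localExt_apply, hx, one_smul]

theorem localExt_self (m : M) (v : V m) :
    localExt I F V m ((trivializationAt F V m).continuousLinearMapAt ℝ m v) m = v := by
  rw [(localExt_eventually_eq m).self_of_nhds,
    Trivialization.symmL_continuousLinearMapAt _ (mem_baseSet_trivializationAt F V m)]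

theorem exists_section_eq (m : M) (v : V m) : ∃ ψ : Cₛ^∞⟮I; F, V⟯, ψ m = v :=
  ⟨_, localExt_self m v⟩

/-- The square of the cutoff function times a section is a combination of the cut off local frame,
with coefficients which vanish where the section vanishes. -/
theorem cutoff_smul_eq_sum [FiniteDimensional ℝ F] (m : M) (ψ : Cₛ^∞⟮I; F, V⟯) :
    ∃ f : Fin (Module.finrank ℝ F) → C^∞⟮I, M; ℝ⟯, (ψ m = 0 → ∀ i, f i m = 0) ∧
      funSMul (cutoff I F V m) (funSMul (cutoff I F V m) ψ) =
        ∑ i, funSMul (f i) (localExt I F V m (Module.finBasis ℝ F i)) := by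
  set e := trivializationAt F V m
  let b := Module.finBasis ℝ F
  let L i : F →L[ℝ] ℝ := LinearMap.toContinuousLinearMap (b.coord i)
  -- One cutoff factor makes the local coordinates of `ψ` smooth on all of `M`; the other is already
  -- contained in `localExt`. This is why the square appears.
  have hsm i : ContMDiff I 𝓘(ℝ, ℝ) ∞
      (fun x => cutoff I F V m x • L i (e ⟨x, ψ x⟩).2) := by
    refine contMDiff_of_tsupport fun x hx => ?_
    have hx' : x ∈ e.baseSet :=
      tsupport_cutoff_subset I F V m (tsupport_smul_subset_left _ _ hx)
    refine (cutoff I F V m).contMDiff.contMDiffAt.smul ?_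
    exact (L i).contMDiff.contMDiffAt.comp x
      ((e.contMDiffAt_section_iff hx').1 ψ.contMDiff.contMDiffAt)
  refine ⟨fun i => ⟨_, hsm i⟩, fun h i => ?_, ?_⟩
  · change cutoff I F V m m • L i (e ⟨m, ψ m⟩).2 = 0
    rw [h, ← Trivialization.continuousLinearMapAt_apply_of_mem ℝ _
      (mem_baseSet_trivializationAt F V m), map_zero, map_zero, smul_zero]
  · ext x
    have hs : (∑ i, funSMul (⟨_, hsm i⟩ : C^∞⟮I, M; ℝ⟯) (localExt I F V m (b i))) x =
        ∑ i, (cutoff I F V m x • L i (e ⟨x, ψ x⟩).2) • localExt I F V m (b i) x := by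
      rw [← ContMDiffSection.coeAddHom_apply, map_sum, Finset.sum_apply]
      rfl
    refine Eq.trans ?_ hs.symm
    change cutoff I F V m x • cutoff I F V m x • ψ x = _
    by_cases hx : x ∈ e.baseSet
    · have h1 : ψ x = ∑ i, L i (e ⟨x, ψ x⟩).2 • e.symmL ℝ x (b i) := by
        simp_rw [← map_smul, ← map_sum]
        have : ∑ i, L i (e ⟨x, ψ x⟩).2 • b i = (e ⟨x, ψ x⟩).2 := b.sum_repr _
        rw [this, ← Trivialization.continuousLinearMapAt_apply_of_mem ℝ _ hx,
          Trivialization.symmL_continuousLinearMapAt _ hx]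
      conv_lhs => rw [h1]
      simp_rw [Finset.smul_sum, localExt_apply]
      refine Finset.sum_congr rfl fun i _ => ?_
      rw [smul_assoc, smul_comm (cutoff I F V m x) (L i _)]
    -- Outside the trivialization domain the cutoff kills both sides.
    · simp [cutoff_eq_zero I F V hx]

end LocalExtension

open ContinuousLinearMap in
/-- A bijective continuous linear map between fibres is invertible. -/
theorem isInvertible_of_bijective {M : Type*} [TopologicalSpace M] (F : Type*)
    [NormedAddCommGroup F] [NormedSpace ℝ F] [FiniteDimensional ℝ F] {V : M → Type*}
    [TopologicalSpace (TotalSpace F V)] [∀ x, AddCommGroup (V x)] [∀ x, Module ℝ (V x)]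
    [∀ x, TopologicalSpace (V x)] [FiberBundle F V] [VectorBundle ℝ F V] {x y : M}
    (A : V x →L[ℝ] V y) (hA : Bijective A) :
    A.IsInvertible := by
  have hx := mem_baseSet_trivializationAt F V x
  have hy := mem_baseSet_trivializationAt F V y
  -- In coordinates the question concerns a linear bijection of the finite-dimensional normed space
  -- `F`, whose inverse is automatically continuous.
  rw [← isInvertible_inCoordinates (F := F) hx hy, inCoordinates_eq hx hy]
  let L := ((trivializationAt F V x).linearEquivAt ℝ x hx).symm.trans
    ((LinearEquiv.ofBijective (A : V x →ₗ[ℝ] V y) hA).trans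
      ((trivializationAt F V y).linearEquivAt ℝ y hy))
  exact ⟨L.toContinuousLinearEquiv, by ext v; rfl⟩

/-! ### Arrows of the frame groupoid and their effect on sections -/

section Frame

open ContinuousLinearMap

variable {EM HM M : Type*} [NormedAddCommGroup EM] [NormedSpace ℝ EM]
  [TopologicalSpace HM] {I : ModelWithCorners ℝ EM HM} [TopologicalSpace M] [ChartedSpace HM M]
  {F : Type*} [NormedAddCommGroup F] [NormedSpace ℝ F] [FiniteDimensional ℝ F]
  {V : M → Type*} [TopologicalSpace (TotalSpace F V)] [∀ x, AddCommGroup (V x)]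
  [∀ x, Module ℝ (V x)] [∀ x, TopologicalSpace (V x)]
  [∀ x, IsTopologicalAddGroup (V x)] [∀ x, ContinuousSMul ℝ (V x)]
  [FiberBundle F V] [VectorBundle ℝ F V] [ContMDiffVectorBundle ∞ F V I]

/-- Casts between equal fibres disappear in the total space, so identities across such fibres are
stated there. -/
theorem mk_fibreCast {x y : M} (h : x = y) (v : V x) :
    (⟨y, fibreCast h v⟩ : TotalSpace F V) = ⟨x, v⟩ := by
  subst h
  rfl

/-- A map to continuous linear maps on a finite dimensional space is smooth if it is so pointwise. -/
theorem contMDiffWithinAt_clm_of_apply {EN HN N : Type*} [NormedAddCommGroup EN] [NormedSpace ℝ EN]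
    [TopologicalSpace HN] {J : ModelWithCorners ℝ EN HN} [TopologicalSpace N] [ChartedSpace HN N]
    {F' : Type*} [NormedAddCommGroup F'] [NormedSpace ℝ F']
    {f : N → F →L[ℝ] F'} {s : Set N} {z : N}
    (h : ∀ v, ContMDiffWithinAt J 𝓘(ℝ, F') ∞ (fun w => f w v) s z) :
    ContMDiffWithinAt J 𝓘(ℝ, F →L[ℝ] F') ∞ f s z := by
  have : CompleteSpace F := FiniteDimensional.complete ℝ F
  let b := Module.finBasis ℝ F
  let c i : F →L[ℝ] ℝ := LinearMap.toContinuousLinearMap (b.coord i)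
  -- Expansion in a basis and its dual: each summand is a fixed continuous linear map applied to the
  -- column `f w (b i)`.
  have hf : f = fun w => ∑ i, ContinuousLinearMap.smulRightL ℝ F F' (c i) (f w (b i)) := by
    funext w
    ext v
    conv_lhs => rw [← b.sum_repr v]
    simp only [map_sum, map_smul, sum_apply]
    rfl
  rw [hf]
  exact contMDiffWithinAt_finsetSum fun i _ =>
    (smulRightL ℝ F F' (c i)).contMDiff.contMDiffAt.comp_contMDiffWithinAt z (h (b i))

namespace FrameArrow

theorem mk_congr {x y x' y' : M} {A : V x →L[ℝ] V y} {B : V x' →L[ℝ] V y'} {hA : A.IsInvertible}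
    {hB : B.IsInvertible} (hx : x = x') (hy : y = y')
    (h : ∀ v, (⟨y, A v⟩ : TotalSpace F V) = ⟨y', B (fibreCast hx v)⟩) :
    (mk A hA : FrameArrow I F V) = mk B hB := by
  subst hx hy
  have : A = B := by
    ext v
    exact TotalSpace.mk_inj.1 (h v)
  subst this
  rfl

/-- Arrows are determined by their source and their effect on the values of sections. -/
theorem ext_apply [FiniteDimensional ℝ EM] [IsManifold I ∞ M] [T2Space M] {a b : FrameArrow I F V}
    (hs : a.src = b.src) (h : ∀ ψ, a.apply ψ = b.apply ψ) : a = b := by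
  -- The targets agree because the images of the zero section lie over them.
  refine mk_congr (A := a.lin) (B := b.lin) (hA := a.isInvertible_lin) (hB := b.isInvertible_lin)
    hs (congrArg TotalSpace.proj (h 0)) fun v => ?_
  obtain ⟨ψ, rfl⟩ := exists_section_eq (I := I) (F := F) a.src v
  refine (h ψ).trans ?_
  have : fibreCast hs (ψ a.src) = ψ b.src := by
    generalize a.src = x at hs
    subst hs
    rfl
  rw [this]
  rfl

/-- The section `φ` needs to match the image of `ψ` only at the single point `b.tgt`. This turns
products of arrows into successive actions on sections. -/
theorem apply_comp (a b : FrameArrow I F V) (h : a.src = b.tgt) {ψ φ : Cₛ^∞⟮I; F, V⟯}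
    (hφ : b.apply ψ = ⟨b.tgt, φ b.tgt⟩) : (comp a b h).apply ψ = a.apply φ := by
  have h1 : b.lin (ψ b.src) = φ b.tgt := TotalSpace.mk_inj.1 hφ
  have h2 : fibreCast h.symm (φ b.tgt) = φ a.src := by
    generalize b.tgt = x at h
    subst h
    rfl
  change (⟨a.tgt, a.lin (fibreCast h.symm (b.lin (ψ b.src)))⟩ : TotalSpace F V) = _
  rw [h1, h2]
  rfl

/-- In trivializations this is a smooth operator-valued function evaluated on a smooth vector-valued
one. -/
theorem contMDiff_apply (ψ : Cₛ^∞⟮I; F, V⟯) :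
    ContMDiff ((I.prod I).prod 𝓘(ℝ, F →L[ℝ] F)) (I.prod 𝓘(ℝ, F)) ∞
      (fun a : FrameArrow I F V => a.apply ψ) := fun a => by
  have h := contMDiffWithinAt_iff.1 (contMDiffWithinAt_id (s := univ) (x := a)
    (I := (I.prod I).prod 𝓘(ℝ, F →L[ℝ] F)) (n := ∞))
  refine (contMDiffWithinAt_totalSpace).2 ⟨h.2.1, ?_⟩
  have hψ := (contMDiffAt_section a.src).1 (ψ.contMDiff.contMDiffAt (x := a.src))
  refine (h.2.2.clm_apply (hψ.comp_contMDiffWithinAt a h.1)).congr_of_eventuallyEq_of_mem ?_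
    (mem_univ _)
  filter_upwards [eventually_mem_baseSet (F := F) (V := V) h.1.continuousWithinAt,
    eventually_mem_baseSet (F := F) (V := V) h.2.1.continuousWithinAt] with w hw1 hw2
  replace hw1 : w.src ∈ (trivializationAt F V a.src).baseSet := hw1
  replace hw2 : w.tgt ∈ (trivializationAt F V a.tgt).baseSet := hw2
  change (trivializationAt F V a.tgt ⟨w.tgt, w.lin (ψ w.src)⟩).2 =
    inCoordinates F V F V a.src w.src a.tgt w.tgt w.lin
      (trivializationAt F V a.src ⟨w.src, ψ w.src⟩).2
  rw [← Trivialization.continuousLinearMapAt_apply_of_mem ℝ _ hw1,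
    ← Trivialization.continuousLinearMapAt_apply_of_mem ℝ _ hw2]
  simp only [inCoordinates, ContinuousLinearMap.comp_apply,
    Trivialization.symmL_continuousLinearMapAt _ hw1]

end FrameArrow

end Frame

/-! ### From semi-linear representations to groupoid representations -/

section SemilinearToGroupoid

open ContinuousLinearMap

variable {EM HM M : Type*} [NormedAddCommGroup EM] [NormedSpace ℝ EM] [FiniteDimensional ℝ EM]
  [TopologicalSpace HM] {I : ModelWithCorners ℝ EM HM} [TopologicalSpace M] [ChartedSpace HM M]
  [IsManifold I ∞ M] [T2Space M]
  {EG HG G : Type*} [NormedAddCommGroup EG] [NormedSpace ℝ EG]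
  [TopologicalSpace HG] {IG : ModelWithCorners ℝ EG HG} [TopologicalSpace G] [ChartedSpace HG G]
  [Group G] [LieGroup IG ∞ G]
  {F : Type*} [NormedAddCommGroup F] [NormedSpace ℝ F] [FiniteDimensional ℝ F]
  {V : M → Type*} [TopologicalSpace (TotalSpace F V)] [∀ x, AddCommGroup (V x)]
  [∀ x, Module ℝ (V x)] [∀ x, TopologicalSpace (V x)]
  [∀ x, IsTopologicalAddGroup (V x)] [∀ x, ContinuousSMul ℝ (V x)]
  [FiberBundle F V] [VectorBundle ℝ F V] [ContMDiffVectorBundle ∞ F V I]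
  [MulAction G M] [ContMDiffSMul IG I ∞ G M]

namespace SemilinearRepresentation

variable (R : SemilinearRepresentation I F V IG G)

theorem act_add (g : G) (ψ φ : Cₛ^∞⟮I; F, V⟯) : R.act g (ψ + φ) = R.act g ψ + R.act g φ :=
  map_add _ _ _

theorem act_sub (g : G) (ψ φ : Cₛ^∞⟮I; F, V⟯) : R.act g (ψ - φ) = R.act g ψ - R.act g φ :=
  map_sub _ _ _

theorem act_mul (g h : G) (ψ : Cₛ^∞⟮I; F, V⟯) : R.act (g * h) ψ = R.act g (R.act h ψ) := by
  unfold act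
  rw [map_mul]
  rfl

theorem act_one (ψ : Cₛ^∞⟮I; F, V⟯) : R.act 1 ψ = ψ := by
  unfold act
  rw [map_one]
  rfl

theorem act_inv_act (g : G) (ψ : Cₛ^∞⟮I; F, V⟯) : R.act g⁻¹ (R.act g ψ) = ψ := by
  rw [← act_mul, inv_mul_cancel, act_one]

theorem act_act_inv (g : G) (ψ : Cₛ^∞⟮I; F, V⟯) : R.act g (R.act g⁻¹ ψ) = ψ := by
  rw [← act_mul, mul_inv_cancel, act_one]

variable {R}

theorem IsAssociated.act_funSMul (hR : R.IsAssociated) (g : G) (f : C^∞⟮I, M; ℝ⟯)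
    (ψ : Cₛ^∞⟮I; F, V⟯) (m : M) : R.act g (funSMul f ψ) (g • m) = f m • R.act g ψ (g • m) := by
  have h : R.act g (funSMul f ψ) (g • m) = f (g⁻¹ • g • m) • R.act g ψ (g • m) :=
    congrArg (fun s : Cₛ^∞⟮I; F, V⟯ => s (g • m)) (hR g f ψ)
  rw [h, inv_smul_smul]

/-- The value of `R g ψ` at `g • m` vanishes if `ψ` vanishes at `m`. -/
theorem IsAssociated.act_eq_zero (hR : R.IsAssociated) (g : G) {ψ : Cₛ^∞⟮I; F, V⟯} {m : M}
    (h : ψ m = 0) : R.act g ψ (g • m) = 0 := by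
  obtain ⟨f, hf, hsum⟩ := cutoff_smul_eq_sum (I := I) m ψ
  have h1 := congrArg (fun s => R.act g s (g • m)) hsum
  -- Both cutoff factors come out with their value at `m`, which is `1`.
  simp only [hR.act_funSMul, cutoff_self, one_smul] at h1
  have h2 : R.act g (∑ i, funSMul (f i) (localExt I F V m (Module.finBasis ℝ F i))) (g • m) =
      ∑ i, R.act g (funSMul (f i) (localExt I F V m (Module.finBasis ℝ F i))) (g • m) := by
    unfold act
    rw [map_sum, ← ContMDiffSection.coeAddHom_apply, map_sum, Finset.sum_apply]
    rfl
  rw [h1, h2]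
  exact Finset.sum_eq_zero fun i _ => by rw [hR.act_funSMul, hf h i, zero_smul]

/-- Apply the vanishing statement to `ψ - φ`. This is what lets `R g` descend to fibres. -/
theorem IsAssociated.act_congr (hR : R.IsAssociated) (g : G) {ψ φ : Cₛ^∞⟮I; F, V⟯} {m : M}
    (h : ψ m = φ m) : R.act g ψ (g • m) = R.act g φ (g • m) := by
  have h1 : R.act g (ψ - φ) (g • m) = 0 := hR.act_eq_zero g (sub_eq_zero.2 h)
  rw [act_sub] at h1
  exact sub_eq_zero.1 h1

/-- The action of a semi-linear representation is injective on the values of sections. -/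
theorem IsAssociated.eq_zero_of_act (hR : R.IsAssociated) (g : G) {ψ : Cₛ^∞⟮I; F, V⟯} {m : M}
    (h : R.act g ψ (g • m) = 0) : ψ m = 0 := by
  have h1 := hR.act_eq_zero g⁻¹ h
  rwa [act_inv_act, inv_smul_smul] at h1

variable (R) in
/-- The linear map `V m → V (g • m)` which sends the value of a section `ψ` at `m` to the value of
`R g ψ` at `g • m`. -/
def fibreMap (g : G) (m : M) : V m →L[ℝ] V (g • m) :=
  -- Factoring through the coordinates in `F` gives continuity for free, by finite dimension.
  (LinearMap.toContinuousLinearMap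
    ({ toFun := fun v => R.act g (localExt I F V m v) (g • m)
       map_add' := fun v w => by
        rw [map_add, act_add]
        rfl
       map_smul' := fun c v => by
        rw [map_smul]
        exact congrArg (fun s : Cₛ^∞⟮I; F, V⟯ => s (g • m)) (map_smul _ c (localExt I F V m v)) } :
      F →ₗ[ℝ] V (g • m))).comp ((trivializationAt F V m).continuousLinearMapAt ℝ m)

theorem IsAssociated.fibreMap_apply (hR : R.IsAssociated) (g : G) (m : M) (ψ : Cₛ^∞⟮I; F, V⟯) :
    R.fibreMap g m (ψ m) = R.act g ψ (g • m) :=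
  hR.act_congr g (localExt_self m (ψ m))

/-- Injectivity is the vanishing statement for `g⁻¹`; a preimage of `φ (g • m)` is the value of `R
g⁻¹ φ` at `m`. -/
theorem IsAssociated.isInvertible_fibreMap (hR : R.IsAssociated) (g : G) (m : M) :
    (R.fibreMap g m).IsInvertible := by
  refine isInvertible_of_bijective F _ ⟨?_, fun w => ?_⟩
  · refine (injective_iff_map_eq_zero _).2 fun v hv => ?_
    obtain ⟨ψ, rfl⟩ := exists_section_eq (I := I) (F := F) m v
    rw [hR.fibreMap_apply] at hv
    exact hR.eq_zero_of_act g hv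
  · obtain ⟨φ, rfl⟩ := exists_section_eq (I := I) (F := F) (g • m) w
    exact ⟨R.act g⁻¹ φ m, by rw [hR.fibreMap_apply, act_act_inv]⟩

/-- The arrow `V m → V (g • m)` of the frame groupoid given by an associated semi-linear
representation. -/
def IsAssociated.arrow (hR : R.IsAssociated) (p : G × M) : FrameArrow I F V :=
  FrameArrow.mk (R.fibreMap p.1 p.2) (hR.isInvertible_fibreMap p.1 p.2)

theorem IsAssociated.arrow_apply (hR : R.IsAssociated) (g : G) (m : M) (ψ : Cₛ^∞⟮I; F, V⟯) :
    (hR.arrow (g, m)).apply ψ = ⟨g • m, R.act g ψ (g • m)⟩ :=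
  congrArg (TotalSpace.mk (g • m)) (hR.fibreMap_apply g m ψ)

theorem contMDiff_act_smul (R : SemilinearRepresentation I F V IG G) (ψ : Cₛ^∞⟮I; F, V⟯) :
    ContMDiff (IG.prod I) (I.prod 𝓘(ℝ, F)) ∞
      (fun p : G × M => TotalSpace.mk' F (p.1 • p.2) (R.act p.1 ψ (p.1 • p.2))) :=
  (R.contMDiff_hom ψ).comp (contMDiff_fst.prodMk
    (ContMDiffSMul.contMDiff_smul (I := IG) (I' := I) (n := ∞) (G := G) (M := M)))

theorem IsAssociated.contMDiff_arrow (hR : R.IsAssociated) :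
    ContMDiff (IG.prod I) ((I.prod I).prod 𝓘(ℝ, F →L[ℝ] F)) ∞ hR.arrow := fun p => by
  have hs : ContMDiff (IG.prod I) I ∞ (fun p : G × M => p.1 • p.2) :=
    ContMDiffSMul.contMDiff_smul
  refine FrameArrow.contMDiffWithinAt_iff.2 ⟨contMDiffWithinAt_snd, hs p, ?_⟩
  refine contMDiffWithinAt_clm_of_apply fun v => ?_
  have h1 := (contMDiffAt_totalSpace.1 (R.contMDiff_act_smul (localExt I F V p.2 v) p)).2
  refine h1.contMDiffWithinAt.congr_of_eventuallyEq_of_mem ?_ (mem_univ _)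
  rw [nhdsWithin_univ]
  filter_upwards [continuous_snd.continuousAt.eventually
      (localExt_eventually_eq (I := I) (F := F) (V := V) p.2),
    hs.continuous.continuousAt.eventually ((trivializationAt F V (p.1 • p.2)).open_baseSet.mem_nhds
      (mem_baseSet_trivializationAt F V _))] with w hw1 hw2
  change (trivializationAt F V (p.1 • p.2)).continuousLinearMapAt ℝ (w.1 • w.2)
      (R.fibreMap w.1 w.2 ((trivializationAt F V p.2).symmL ℝ w.2 v)) =
    (trivializationAt F V (p.1 • p.2) ⟨w.1 • w.2, R.act w.1 (localExt I F V p.2 v) (w.1 • w.2)⟩).2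
  -- `fibreMap` at `w` uses an extension centred at the moving point `w.2`. Independence of the
  -- extension replaces it by the fixed section centred at `p.2`, for which smoothness in `(g, m)`
  -- is known.
  rw [← hw1, hR.fibreMap_apply, Trivialization.continuousLinearMapAt_apply_of_mem ℝ _ hw2]

/-- The representation of the action groupoid given by an associated semi-linear representation. -/
def IsAssociated.groupoidRepresentation (hR : R.IsAssociated) :
    GroupoidRepresentation (actionGroupoid IG G I M) F V where
  toFun := hR.arrow
  contMDiff_toFun := hR.contMDiff_arrow
  src_toFun _ := rfl
  tgt_toFun _ := rfl
  map_mul := by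
    rintro ⟨g, x⟩ ⟨h, m⟩ hx
    obtain rfl : x = h • m := hx
    refine FrameArrow.ext_apply rfl fun ψ => ?_
    refine Eq.trans ?_ (FrameArrow.apply_comp (hR.arrow (g, h • m)) (hR.arrow (h, m)) rfl
      (hR.arrow_apply h m ψ)).symm
    refine (hR.arrow_apply (g * h) m ψ).trans (Eq.trans ?_ (hR.arrow_apply g (h • m) _).symm)
    rw [act_mul, mul_smul]

theorem ext_act {R R' : SemilinearRepresentation I F V IG G}
    (h : ∀ g ψ, R.act g ψ = R'.act g ψ) : R = R' := by
  obtain ⟨f, hf⟩ := R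
  obtain ⟨f', hf'⟩ := R'
  obtain rfl : f = f' := MonoidHom.ext fun g => Subtype.ext (LinearEquiv.ext (h g))
  rfl

end SemilinearRepresentation

end SemilinearToGroupoid

/-! ### From groupoid representations to semi-linear representations -/

section GroupoidToSemilinear

variable {EM HM M : Type*} [NormedAddCommGroup EM] [NormedSpace ℝ EM] [FiniteDimensional ℝ EM]
  [TopologicalSpace HM] {I : ModelWithCorners ℝ EM HM} [TopologicalSpace M] [ChartedSpace HM M]
  [IsManifold I ∞ M] [T2Space M]
  {EG HG G : Type*} [NormedAddCommGroup EG] [NormedSpace ℝ EG]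
  [TopologicalSpace HG] {IG : ModelWithCorners ℝ EG HG} [TopologicalSpace G] [ChartedSpace HG G]
  [Group G] [LieGroup IG ∞ G]
  {F : Type*} [NormedAddCommGroup F] [NormedSpace ℝ F] [FiniteDimensional ℝ F]
  {V : M → Type*} [TopologicalSpace (TotalSpace F V)] [∀ x, AddCommGroup (V x)]
  [∀ x, Module ℝ (V x)] [∀ x, TopologicalSpace (V x)]
  [∀ x, IsTopologicalAddGroup (V x)] [∀ x, ContinuousSMul ℝ (V x)]
  [FiberBundle F V] [VectorBundle ℝ F V] [ContMDiffVectorBundle ∞ F V I]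
  [MulAction G M] [ContMDiffSMul IG I ∞ G M]

namespace GroupoidRepresentation

variable (ρ : GroupoidRepresentation (actionGroupoid IG G I M) F V)

theorem tgt_inv_smul (g : G) (m : M) : (ρ.toFun (g, g⁻¹ • m)).tgt = m :=
  (ρ.tgt_toFun _).trans (smul_inv_smul g m)

/-- The value at `m` of the section `m ↦ ρ (g, g⁻¹ • m) (ψ (g⁻¹ • m))`. -/
def actVal (g : G) (ψ : Cₛ^∞⟮I; F, V⟯) (m : M) : V m :=
  fibreCast (tgt_inv_smul ρ g m)
    ((ρ.toFun (g, g⁻¹ • m)).lin (ψ (ρ.toFun (g, g⁻¹ • m)).src))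

theorem mk_actVal (g : G) (ψ : Cₛ^∞⟮I; F, V⟯) (m : M) :
    TotalSpace.mk' F m (actVal ρ g ψ m) = (ρ.toFun (g, g⁻¹ • m)).apply ψ :=
  mk_fibreCast _ _

/-- Up to the cast, this is `(g, m) ↦ (g, g⁻¹ • m)`, followed by `ρ` and by evaluation on `ψ`. -/
theorem contMDiff_actVal (ψ : Cₛ^∞⟮I; F, V⟯) : ContMDiff (IG.prod I) (I.prod 𝓘(ℝ, F)) ∞
    (fun p : G × M => TotalSpace.mk' F p.2 (actVal ρ p.1 ψ p.2)) := by
  simp_rw [mk_actVal]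
  exact ((FrameArrow.contMDiff_apply ψ).comp ρ.contMDiff_toFun).comp
    (contMDiff_fst.prodMk ((ContMDiffSMul.contMDiff_smul (I := IG) (I' := I) (n := ∞) (G := G)
      (M := M)).comp (((contMDiff_inv IG ∞).comp contMDiff_fst).prodMk contMDiff_snd)))

/-- The linear map `ψ ↦ (m ↦ ρ (g, g⁻¹ • m) (ψ (g⁻¹ • m)))`. -/
def actHom (g : G) : Cₛ^∞⟮I; F, V⟯ →ₗ[ℝ] Cₛ^∞⟮I; F, V⟯ where
  toFun ψ := ⟨actVal ρ g ψ, (contMDiff_actVal ρ ψ).comp (contMDiff_const.prodMk contMDiff_id)⟩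
  map_add' ψ φ := by
    ext m
    refine (congrArg (fibreCast (tgt_inv_smul ρ g m)) (map_add (ρ.toFun (g, g⁻¹ • m)).lin
      (ψ _) (φ _))).trans ?_
    exact map_add (fibreCast (tgt_inv_smul ρ g m)) _ _
  map_smul' c ψ := by
    ext m
    refine (congrArg (fibreCast (tgt_inv_smul ρ g m)) (map_smul (ρ.toFun (g, g⁻¹ • m)).lin
      c (ψ _))).trans ?_
    exact map_smul (fibreCast (tgt_inv_smul ρ g m)) c _

theorem mk_actHom (g : G) (ψ : Cₛ^∞⟮I; F, V⟯) (m : M) :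
    (⟨m, actHom ρ g ψ m⟩ : TotalSpace F V) = (ρ.toFun (g, g⁻¹ • m)).apply ψ :=
  mk_actVal ρ g ψ m

theorem toFun_apply (g : G) (ψ : Cₛ^∞⟮I; F, V⟯) (m : M) :
    (ρ.toFun (g, m)).apply ψ = ⟨g • m, actHom ρ g ψ (g • m)⟩ := by
  rw [mk_actHom, inv_smul_smul]

/-- The shape required by the hypothesis of `FrameArrow.apply_comp`. -/
theorem toFun_apply_tgt (g : G) (ψ : Cₛ^∞⟮I; F, V⟯) (m : M) : (ρ.toFun (g, m)).apply ψ =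
    ⟨(ρ.toFun (g, m)).tgt, actHom ρ g ψ (ρ.toFun (g, m)).tgt⟩ := by
  have h : (ρ.toFun (g, m)).tgt = g • m := ρ.tgt_toFun (g, m)
  rw [h, toFun_apply]

theorem actHom_mul (g h : G) (ψ : Cₛ^∞⟮I; F, V⟯) :
    actHom ρ (g * h) ψ = actHom ρ g (actHom ρ h ψ) := by
  ext m
  -- Writing the point as `g • h • x` makes it the target of the product of the arrows at `(g, h •
  -- x)` and `(h, x)`.
  have hm : m = g • h • (g * h)⁻¹ • m := by rw [← mul_smul, smul_inv_smul]
  generalize (g * h)⁻¹ • m = x at hm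
  subst hm
  have h1 : (ρ.toFun (g * h, x)).apply ψ = (ρ.toFun (g, h • x)).apply (actHom ρ h ψ) := by
    refine (congrArg (fun a => FrameArrow.apply a ψ) (ρ.map_mul (g, h • x) (h, x) rfl)).trans ?_
    exact FrameArrow.apply_comp _ _
      ((ρ.src_toFun (g, h • x)).trans (ρ.tgt_toFun (h, x)).symm) (toFun_apply_tgt ρ h ψ x)
  rw [toFun_apply, toFun_apply, mul_smul] at h1
  exact TotalSpace.mk_inj.1 h1

theorem injective_actHom (g : G) : Injective (actHom ρ g) := by
  refine (injective_iff_map_eq_zero _).2 fun ψ hψ => ?_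
  ext m
  have h1 := toFun_apply_tgt ρ g ψ m
  rw [hψ] at h1
  have h2 : (ρ.toFun (g, m)).lin (ψ (ρ.toFun (g, m)).src) = 0 := TotalSpace.mk_inj.1 h1
  have h3 : ψ (ρ.toFun (g, m)).src = 0 :=
    (ρ.toFun (g, m)).isInvertible_lin.injective (h2.trans (map_zero _).symm)
  have h4 : (ρ.toFun (g, m)).src = m := ρ.src_toFun (g, m)
  rwa [h4] at h3

/-- Morphisms are only required to preserve products. Since `1 * 1 = 1`, the map is idempotent, and
an injective idempotent is the identity. -/
theorem actHom_one (ψ : Cₛ^∞⟮I; F, V⟯) : actHom ρ 1 ψ = ψ :=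
  injective_actHom ρ 1 (by rw [← actHom_mul, one_mul])

/-- The linear automorphism `actHom ρ g`, with inverse `actHom ρ g⁻¹`. -/
def actEquiv (g : G) : Cₛ^∞⟮I; F, V⟯ ≃ₗ[ℝ] Cₛ^∞⟮I; F, V⟯ :=
  { actHom ρ g with
    invFun := actHom ρ g⁻¹
    left_inv := fun ψ => (actHom_mul ρ g⁻¹ g ψ).symm.trans (by rw [inv_mul_cancel, actHom_one])
    right_inv := fun ψ => (actHom_mul ρ g g⁻¹ ψ).symm.trans (by rw [mul_inv_cancel, actHom_one]) }

/-- Arrows are linear on fibres, so `f` comes out with its value at the source `g⁻¹ • m`. -/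
theorem isSemilinearOver_actEquiv (g : G) :
    IsSemilinearOver (actEquiv ρ g) (translate M I IG g) := fun f ψ => by
  ext m
  have h : (ρ.toFun (g, g⁻¹ • m)).src = g⁻¹ • m := ρ.src_toFun (g, g⁻¹ • m)
  change fibreCast (tgt_inv_smul ρ g m) ((ρ.toFun (g, g⁻¹ • m)).lin
    (f (ρ.toFun (g, g⁻¹ • m)).src • ψ (ρ.toFun (g, g⁻¹ • m)).src)) =
      f (g⁻¹ • m) • actVal ρ g ψ m
  rw [map_smul, map_smul, actVal]
  exact congrArg (f · • _) h

/-- The semi-linear representation given by a representation of the action groupoid. -/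
def semilinearRepresentation : SemilinearRepresentation I F V IG G where
  hom :=
    { toFun := fun g => ⟨actEquiv ρ g, translate M I IG g, isSemilinearOver_actEquiv ρ g⟩
      map_one' := Subtype.ext (LinearEquiv.ext (actHom_one ρ))
      map_mul' := fun g h => Subtype.ext (LinearEquiv.ext (actHom_mul ρ g h)) }
  contMDiff_hom := contMDiff_actVal ρ

theorem isAssociated_semilinearRepresentation : (semilinearRepresentation ρ).IsAssociated :=
  isSemilinearOver_actEquiv ρ

theorem apply_eq_act (g : G) (m : M) (ψ : Cₛ^∞⟮I; F, V⟯) :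
    (ρ.toFun (g, m)).apply ψ = ⟨g • m, (semilinearRepresentation ρ).act g ψ (g • m)⟩ :=
  toFun_apply ρ g ψ m

/-- Representations of the action groupoid are determined by their effect on the values of
sections. -/
theorem ext_apply {ρ σ : GroupoidRepresentation (actionGroupoid IG G I M) F V}
    (h : ∀ p ψ, (ρ.toFun p).apply ψ = (σ.toFun p).apply ψ) : ρ = σ := by
  have h1 : ρ.toFun = σ.toFun := funext fun p =>
    FrameArrow.ext_apply ((ρ.src_toFun p).trans (σ.src_toFun p).symm) (h p)
  cases ρ
  cases σ
  cases h1
  rfl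

end GroupoidRepresentation

/-! ### The bijection -/

/-- Associated semi-linear representations of `G` are the same as representations of the action
groupoid. -/
def semilinearEquivGroupoid : {R : SemilinearRepresentation I F V IG G // R.IsAssociated} ≃
    GroupoidRepresentation (actionGroupoid IG G I M) F V where
  toFun R := R.2.groupoidRepresentation
  invFun ρ := ⟨GroupoidRepresentation.semilinearRepresentation ρ,
    GroupoidRepresentation.isAssociated_semilinearRepresentation ρ⟩
  left_inv R := by
    refine Subtype.ext (SemilinearRepresentation.ext_act fun g ψ => ?_)
    ext m
    -- At `g • x` both sections are the image of `ψ x` under the same arrow.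
    obtain ⟨x, rfl⟩ := MulAction.surjective g m
    exact TotalSpace.mk_inj.1
      ((GroupoidRepresentation.apply_eq_act R.2.groupoidRepresentation g x ψ).symm.trans
        (R.2.arrow_apply g x ψ))
  right_inv ρ := GroupoidRepresentation.ext_apply fun p ψ =>
    ((GroupoidRepresentation.isAssociated_semilinearRepresentation ρ).arrow_apply p.1 p.2 ψ).trans
      (GroupoidRepresentation.apply_eq_act ρ p.1 p.2 ψ).symm

end GroupoidToSemilinear

end

end GroupoidReps

theorem theorem4p6
    {EM HM M : Type*} [NormedAddCommGroup EM] [NormedSpace ℝ EM] [FiniteDimensional ℝ EM]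
    [TopologicalSpace HM] (I : ModelWithCorners ℝ EM HM) [TopologicalSpace M] [ChartedSpace HM M]
    [IsManifold I ∞ M] [BoundarylessManifold I M] [T2Space M] [SecondCountableTopology M]
    {EG HG G : Type*} [NormedAddCommGroup EG] [NormedSpace ℝ EG] [FiniteDimensional ℝ EG]
    [TopologicalSpace HG] (IG : ModelWithCorners ℝ EG HG) [TopologicalSpace G] [ChartedSpace HG G]
    [Group G] [LieGroup IG ∞ G] [BoundarylessManifold IG G] [T2Space G]
    [SecondCountableTopology G]
    (F : Type*) [NormedAddCommGroup F] [NormedSpace ℝ F] [FiniteDimensional ℝ F]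
    (V : M → Type*) [TopologicalSpace (TotalSpace F V)] [∀ x, AddCommGroup (V x)]
    [∀ x, Module ℝ (V x)] [∀ x, TopologicalSpace (V x)] [∀ x, IsTopologicalAddGroup (V x)]
    [∀ x, ContinuousSMul ℝ (V x)] [FiberBundle F V] [VectorBundle ℝ F V]
    [ContMDiffVectorBundle ∞ F V I]
    [MulAction G M] [ContMDiffSMul IG I ∞ G M] :
    ∃ Θ : {R : GroupoidReps.SemilinearRepresentation I F V IG G // R.IsAssociated} ≃
        GroupoidReps.GroupoidRepresentation (GroupoidReps.actionGroupoid IG G I M) F V,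
      ∀ (R : {R : GroupoidReps.SemilinearRepresentation I F V IG G // R.IsAssociated})
        (g : G) (m : M) (ψ : Cₛ^∞⟮I; F, V⟯),
        ((Θ R).toFun (g, m)).apply ψ = ⟨g • m, R.1.act g ψ (g • m)⟩ :=
  ⟨GroupoidReps.semilinearEquivGroupoid, fun R g m ψ => R.2.arrow_apply g m ψ⟩
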